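/- Let $G$ be a countable discrete amenable group acting by homeomorphisms $T_g$, $g\in G$, on a compact metrizable space $X$, let $R$ be a commutative unital ring, and let $k\ge 0$ be an even integer. Then \[ \mathrm{mcid}_k(T;R)\le \mathrm{mdim}(T), \] where the two quantities are defined as follows. For closed $Y\subseteq X$, a \emph{finite open cover of $Y$ in $X$} is a finite set $\mathcal U$ of nonempty open subsets of $X$ whose union contains $Y$. Its order is $\mathrm{ord}(\mathcal U)=\max_{x\in X}\mathrm{Card}\{U\in\mathcal U: x\in U\}-1$, and $\mathcal D_Y(\mathcal U)$ is the least order of a finite open cover $\mathcal V$ of $Y$ in $X$ that refines $\mathcal U$ (every $V\in\mathcal V$ is contained in some $U\in\mathcal U$). For $F\subseteq G$ finite, $\bigvee_{g\in F}T_g^{-1}(\mathcal U)$ is the set of all nonempty sets $\bigcap_{g\in F}T_g^{-1}(U_g)$ with $U_g\in\mathcal U$. Let $\check H^k(Y;\mathcal U;R)$ be the set of those classes in the \v{C}ech cohomology $\check H^k(Y;R)$ that are represented by cocycles on the nerve of the cover $\{U\cap Y : U\in\mathcal U,\ U\cap Y\ne\varnothing\}$ of $Y$. For $G_0\subseteq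 G$ finite and $\delta>0$, a nonempty finite set $F\subseteq G$ is \emph{$(G_0,\delta)$-invariant} if $\mathrm{Card}(gF\cap F)>(1-\delta)\,\mathrm{Card}(F)$ for all $g\in G_0$. The \emph{mean dimension} $\mathrm{mdim}(T)\in[0,\infty]$ is \[ \mathrm{mdim}(T)=\sup_{\mathcal U}\ \lim_{F}\ \frac{\mathcal D_X\bigl(\bigvee_{g\in F}T_g^{-1}(\mathcal U)\bigr)}{\mathrm{Card}(F)}, \] where $\mathcal U$ runs over the finite open covers of $X$ and the limit is taken as $F$ becomes more and more invariant, that is, along the $(G_0,\delta)$-invariant sets as $G_0$ increases and $\delta\to0$ (and $\mathrm{mdim}(T)=0$ if $X=\varnothing$). The \emph{mean $k$-th cohomological independence dimension} $\mathrm{mcid}_k(T;R)$ is the largest $d\in[0,\infty)$ with the following property (and $0$ if there is no such $d$): for every $\varepsilon>0$ there are a closed set $Y\subseteq X$, a finite open cover $\mathcal U$ of $Y$ in $X$ with $\mathcal D_Y(\mathcal U)\in\{k,k+1\}$, and a class $\eta\in\check H^k(Y;\mathcal U;R)$, such that for every finite $G_0\subseteq G$ and every $\delta>0$ there are a $(G_0,\delta)$-invariant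 finite set $F\subseteq G$ and a subset $F_0\subseteq F$ such that \begin{enumerate} \item the cup product over all $g\in F_0$ of the restrictions of $T_g^*(\eta)$ to $\bigcap_{h\in F_0}T_h^{-1}(Y)$ is nonzero in $\check H^{k\,\mathrm{Card}(F_0)}\bigl(\bigcap_{h\in F_0}T_h^{-1}(Y);R\bigr)$ (the empty product is $1\in\check H^0(X;R)$), and \item $k\,\mathrm{Card}(F_0)/\mathrm{Card}(F)>d-\varepsilon$. \end{enumerate} -/

import Mathlib

open scoped ENNReal NNReal

noncomputable section

namespace MeanCoh

universe u v

/-! ### Čech cohomology with its cup product -/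

/-- An indexed finite open cover of a space (the index type has the universe of the space, so that
every finite set of open subsets occurs). Empty members are harmless: they span no simplices. -/
structure FinCover (Y : Type u) [TopologicalSpace Y] : Type (u + 1) where
  ι : Type u
  finite : Finite ι
  U : ι → Set Y
  isOpen : ∀ i, IsOpen (U i)
  covers : ⋃ i, U i = Set.univ

/-- The ordered `n`-simplices of the nerve of a family of sets: `(n+1)`-tuples of indices whose
sets have nonempty intersection. -/
def Simplex {Y : Type u} {ι : Type u} (U : ι → Set Y) (n : ℕ) : Type u :=
  {s : Fin (n + 1) → ι // (⋂ i, U (s i)).Nonempty}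

/-- Reindexing the vertices of a simplex. -/
def Simplex.comp {Y : Type u} {ι : Type u} {U : ι → Set Y} {n m : ℕ} (s : Simplex U n)
    (φ : Fin (m + 1) → Fin (n + 1)) : Simplex U m :=
  ⟨fun i => s.1 (φ i), s.2.mono fun _ hx => Set.mem_iInter.2 fun i => Set.mem_iInter.1 hx (φ i)⟩

/-- `n`-cochains of the nerve with coefficients in `R`. -/
abbrev Cochain {Y : Type u} {ι : Type u} (U : ι → Set Y) (R : Type v) (n : ℕ) : Type (max u v) :=
  Simplex U n → R

/-- The simplicial coboundary. -/
def coboundary {Y : Type u} {ι : Type u} {U : ι → Set Y} {R : Type v} [CommRing R] {n : ℕ}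
    (c : Cochain U R n) : Cochain U R (n + 1) :=
  fun s => ∑ i : Fin (n + 2), (-1) ^ (i : ℕ) * c (s.comp i.succAbove)

/-- `c` lies in the image of the coboundary; in degree `0` this means `c = 0`. -/
def IsCoboundary {Y : Type u} {ι : Type u} {U : ι → Set Y} {R : Type v} [CommRing R] {n : ℕ}
    (c : Cochain U R n) : Prop :=
  c = 0 ∨ ∃ (m : ℕ) (h : m + 1 = n) (e : Cochain U R m),
    ∀ s, c s = coboundary e (s.comp (Fin.cast (by rw [h])))

/-- The cup product of cochains: front `p`-face times back `q`-face. -/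
def cochainCup {Y : Type u} {ι : Type u} {U : ι → Set Y} {R : Type v} [CommRing R] {p q : ℕ}
    (a : Cochain U R p) (b : Cochain U R q) : Cochain U R (p + q) :=
  fun s => a (s.comp fun i => ⟨i, by omega⟩) * b (s.comp fun j => ⟨p + j, by omega⟩)

/-- Pull-back of cochains along a map of spaces `f` and a map of index sets `π` with
`f (V j) ⊆ U (π j)`. For `f = id` this is the map induced by a refinement. -/
def pull {Y Z : Type u} {ι κ : Type u} {U : ι → Set Y} {V : κ → Set Z} {R : Type v} {n : ℕ}
    (f : Z → Y) (π : κ → ι) (h : ∀ j, Set.MapsTo f (V j) (U (π j))) (c : Cochain U R n) :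
    Cochain V R n :=
  fun s => c ⟨fun i => π (s.1 i), by
    obtain ⟨x, hx⟩ := s.2
    exact ⟨f x, Set.mem_iInter.2 fun i => h _ (Set.mem_iInter.1 hx i)⟩⟩

section CochainLemmas

variable {Y Z : Type u} {ι κ : Type u} {U : ι → Set Y} {V : κ → Set Z} {R : Type v} [CommRing R]

theorem coboundary_pull {n : ℕ} (f : Z → Y) (π : κ → ι) (h : ∀ j, Set.MapsTo f (V j) (U (π j)))
    (c : Cochain U R n) : coboundary (pull f π h c) = pull f π h (coboundary c) := rfl

theorem coboundary_pull_eq_zero {n : ℕ} (f : Z → Y) (π : κ → ι)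
    (h : ∀ j, Set.MapsTo f (V j) (U (π j))) {c : Cochain U R n} (hc : coboundary c = 0) :
    coboundary (pull f π h c) = 0 := by
  rw [coboundary_pull, hc]
  rfl

theorem cochainCup_pull {p q : ℕ} (f : Z → Y) (π : κ → ι)
    (h : ∀ j, Set.MapsTo f (V j) (U (π j))) (a : Cochain U R p) (b : Cochain U R q) :
    cochainCup (pull f π h a) (pull f π h b) = pull f π h (cochainCup a b) := rfl

theorem IsCoboundary.pull {n : ℕ} (f : Z → Y) (π : κ → ι)
    (h : ∀ j, Set.MapsTo f (V j) (U (π j))) {c : Cochain U R n} (hc : IsCoboundary c) :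
    IsCoboundary (pull f π h c) := by
  rcases hc with rfl | ⟨m, hm, e, he⟩
  · exact Or.inl rfl
  · exact Or.inr ⟨m, hm, MeanCoh.pull f π h e, fun s => he _⟩

/-- The Leibniz rule. -/
theorem coboundary_cup {p q : ℕ} (a : Cochain U R p) (b : Cochain U R q)
    (s : Simplex U (p + q + 1)) :
    coboundary (cochainCup a b) s =
      cochainCup (coboundary a) b (s.comp (m := p + 1 + q) (Fin.cast (by omega))) +
        (-1) ^ p * cochainCup a (coboundary b) s := by
  have e : (p + 1) + (q + 1) = p + q + 2 := by omega
  have key : coboundary (cochainCup a b) s =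
      (∑ i : Fin (p + 1), (-1) ^ (i : ℕ) *
        cochainCup a b (s.comp (Fin.succAbove ⟨i, by omega⟩))) +
      ∑ j : Fin (q + 1), (-1) ^ (p + 1 + j : ℕ) *
        cochainCup a b (s.comp (Fin.succAbove ⟨p + 1 + j, by omega⟩)) := by
    unfold coboundary
    rw [← (finCongr e).sum_comp, Fin.sum_univ_add]
    rfl
  rw [key]
  simp only [cochainCup, coboundary]
  conv_rhs =>
    rw [Fin.sum_univ_castSucc, add_mul, Finset.sum_mul]
    rw [Fin.sum_univ_succ (n := q + 1), mul_add, mul_add, Finset.mul_sum, Finset.mul_sum]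
  have h1 : ∀ i : Fin (p + 1),
      (-1) ^ (i : ℕ) *
        (a ((s.comp (Fin.succAbove ⟨i, by omega⟩)).comp (m := p) fun i => ⟨i, by omega⟩) *
          b ((s.comp (Fin.succAbove ⟨i, by omega⟩)).comp (m := q) fun j => ⟨p + j, by omega⟩)) =
      (-1) ^ (i.castSucc : ℕ) *
        a (((s.comp (m := p + 1 + q) (Fin.cast (by omega))).comp (m := p + 1)
          fun i => ⟨i, by omega⟩).comp i.castSucc.succAbove) *
        b ((s.comp (m := p + 1 + q) (Fin.cast (by omega))).comp (m := q)
          fun j => ⟨p + 1 + j, by omega⟩) := by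
    intro i
    rw [mul_assoc]
    congr 2
    · congr 1
      apply Subtype.ext
      funext j
      refine congrArg s.1 (Fin.ext ?_)
      simp only [Fin.succAbove, Fin.lt_def, Fin.val_cast, Fin.val_castSucc]
      split_ifs <;> simp
    · congr 1
      apply Subtype.ext
      funext j
      refine congrArg s.1 (Fin.ext ?_)
      simp only [Fin.succAbove, Fin.lt_def, Fin.val_cast, Fin.val_castSucc]
      rw [if_neg (by omega)]
      simp
      omega
  have h2 : ∀ j : Fin (q + 1),
      (-1) ^ (p + 1 + j : ℕ) *
        (a ((s.comp (Fin.succAbove ⟨p + 1 + j, by omega⟩)).comp (m := p) fun i => ⟨i, by omega⟩) *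
          b ((s.comp (Fin.succAbove ⟨p + 1 + j, by omega⟩)).comp (m := q)
            fun j => ⟨p + j, by omega⟩)) =
      (-1) ^ p * (a (s.comp (m := p) fun i => ⟨i, by omega⟩) *
        ((-1) ^ (j.succ : ℕ) *
          b ((s.comp (m := q + 1) fun j => ⟨p + j, by omega⟩).comp j.succ.succAbove))) := by
    intro j
    have ha : ((s.comp (Fin.succAbove ⟨p + 1 + j, by omega⟩)).comp (m := p)
        fun i => ⟨i, by omega⟩) = s.comp (m := p) fun i => ⟨i, by omega⟩ := by
      apply Subtype.ext
      funext i
      refine congrArg s.1 (Fin.ext ?_)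
      simp only [Fin.succAbove, Fin.lt_def, Fin.val_castSucc]
      rw [if_pos (by omega)]
      simp
    have hb : ((s.comp (Fin.succAbove ⟨p + 1 + j, by omega⟩)).comp (m := q)
        fun j => ⟨p + j, by omega⟩) =
        (s.comp (m := q + 1) fun j => ⟨p + j, by omega⟩).comp j.succ.succAbove := by
      apply Subtype.ext
      funext i
      refine congrArg s.1 (Fin.ext ?_)
      simp only [Fin.succAbove, Fin.lt_def, Fin.val_castSucc, Fin.val_succ]
      split_ifs <;> simp <;> omega
    rw [ha, hb, Fin.val_succ]
    ring
  rw [Finset.sum_congr rfl fun i _ => h1 i, Finset.sum_congr rfl fun j _ => h2 j]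
  have h3 : a (((s.comp (m := p + 1 + q) (Fin.cast (by omega))).comp (m := p + 1)
          fun i => ⟨i, by omega⟩).comp (Fin.last (p + 1)).succAbove) =
      a (s.comp (m := p) fun i => ⟨i, by omega⟩) := by
    congr 1
    apply Subtype.ext
    funext i
    refine congrArg s.1 (Fin.ext ?_)
    simp
  have h4 : b ((s.comp (m := q + 1) fun j => ⟨p + j, by omega⟩).comp (0 : Fin (q + 2)).succAbove) =
      b ((s.comp (m := p + 1 + q) (Fin.cast (by omega))).comp (m := q)
          fun j => ⟨p + 1 + j, by omega⟩) := by
    congr 1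
    apply Subtype.ext
    funext i
    refine congrArg s.1 (Fin.ext ?_)
    simp
    omega
  rw [h3, h4]
  simp only [Fin.val_last, Fin.val_zero]
  ring

theorem coboundary_zero {n : ℕ} : coboundary (0 : Cochain U R n) = 0 := by
  funext s
  simp [coboundary]

theorem coboundary_cup_eq_zero {p q : ℕ} {a : Cochain U R p} {b : Cochain U R q}
    (ha : coboundary a = 0) (hb : coboundary b = 0) : coboundary (cochainCup a b) = 0 := by
  funext s
  rw [coboundary_cup, ha, hb]
  simp [cochainCup]

theorem IsCoboundary.cup_right {p q : ℕ} {a : Cochain U R p} {b : Cochain U R q}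
    (ha : IsCoboundary a) (hb : coboundary b = 0) : IsCoboundary (cochainCup a b) := by
  rcases ha with rfl | ⟨m, rfl, e, he⟩
  · exact Or.inl (by funext s; simp [cochainCup])
  · refine Or.inr ⟨m + q, by omega, cochainCup e b, fun s => ?_⟩
    obtain rfl : a = coboundary e := funext he
    rw [coboundary_cup, hb]
    simp only [cochainCup, Pi.zero_apply, mul_zero, add_zero]
    rfl

theorem IsCoboundary.cup_left {p q : ℕ} {a : Cochain U R p} {b : Cochain U R q}
    (ha : coboundary a = 0) (hb : IsCoboundary b) : IsCoboundary (cochainCup a b) := by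
  rcases hb with rfl | ⟨m, rfl, e, he⟩
  · exact Or.inl (by funext s; simp [cochainCup])
  · refine Or.inr ⟨p + m, by omega, cochainCup ((-1) ^ p * a) e, fun s => ?_⟩
    obtain rfl : b = coboundary e := funext he
    have ha' : coboundary ((-1) ^ p * a) = 0 := by
      funext s
      have := congrFun ha s
      simp only [coboundary, Pi.zero_apply] at this
      simp only [coboundary, Pi.mul_apply, Pi.pow_apply, Pi.neg_apply, Pi.one_apply,
        Pi.zero_apply]
      simp_rw [mul_left_comm _ ((-1 : R) ^ p)]
      rw [← Finset.mul_sum, this, mul_zero]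
    rw [coboundary_cup, ha']
    simp only [cochainCup, Pi.zero_apply, zero_mul, zero_add, Pi.mul_apply, Pi.pow_apply,
      Pi.neg_apply, Pi.one_apply]
    rw [← mul_assoc, ← mul_assoc, ← pow_add, Even.neg_one_pow ⟨p, rfl⟩, one_mul]
    rfl

end CochainLemmas

/-- An `n`-cocycle on the nerve of some finite open cover of `Y`. -/
structure CechCocycle (Y : Type u) [TopologicalSpace Y] (R : Type v) [CommRing R] (n : ℕ) :
    Type (max (u + 1) v) where
  cover : FinCover Y
  cochain : Cochain cover.U R n
  closed : coboundary cochain = 0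

/-- `y` lives on a refinement of the cover of `x` and is there cohomologous to the pull-back
of `x`. -/
def CechCocycle.Rel {Y : Type u} [TopologicalSpace Y] {R : Type v} [CommRing R] {n : ℕ}
    (x y : CechCocycle Y R n) : Prop :=
  ∃ (π : y.cover.ι → x.cover.ι) (h : ∀ j, Set.MapsTo id (y.cover.U j) (x.cover.U (π j))),
    IsCoboundary (y.cochain - pull id π h x.cochain)

/-- Čech cohomology (of a compact space): the direct limit, over finite open covers and
refinements, of the cohomology of nerves. `Quot` divides by the equivalence relation generated
by `Rel`, which is precisely the one defining this direct limit. -/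
def CechH (Y : Type u) [TopologicalSpace Y] (R : Type v) [CommRing R] (n : ℕ) :
    Type (max (u + 1) v) :=
  Quot (CechCocycle.Rel (Y := Y) (R := R) (n := n))

section CechOps

variable {Y Z : Type u} [TopologicalSpace Y] [TopologicalSpace Z] {R : Type v} [CommRing R]

/-- The one-element cover. -/
abbrev FinCover.trivial (Y : Type u) [TopologicalSpace Y] : FinCover Y where
  ι := PUnit
  finite := inferInstance
  U := fun _ => Set.univ
  isOpen := fun _ => isOpen_univ
  covers := Set.iUnion_const _

/-- The common refinement of two covers. -/
abbrev FinCover.join (𝒰 𝒱 : FinCover Y) : FinCover Y where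
  ι := 𝒰.ι × 𝒱.ι
  finite := by
    have := 𝒰.finite
    have := 𝒱.finite
    infer_instance
  U := fun i => 𝒰.U i.1 ∩ 𝒱.U i.2
  isOpen := fun i => (𝒰.isOpen i.1).inter (𝒱.isOpen i.2)
  covers := by
    refine Set.eq_univ_of_forall fun x => ?_
    obtain ⟨i, hi⟩ := Set.mem_iUnion.1 (𝒰.covers ▸ Set.mem_univ x)
    obtain ⟨j, hj⟩ := Set.mem_iUnion.1 (𝒱.covers ▸ Set.mem_univ x)
    exact Set.mem_iUnion.2 ⟨(i, j), hi, hj⟩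

/-- The preimage of a cover under a continuous map. -/
abbrev FinCover.preimage (f : C(Z, Y)) (𝒰 : FinCover Y) : FinCover Z where
  ι := 𝒰.ι
  finite := 𝒰.finite
  U := fun i => f ⁻¹' 𝒰.U i
  isOpen := fun i => (𝒰.isOpen i).preimage f.continuous
  covers := by rw [← Set.preimage_iUnion, 𝒰.covers, Set.preimage_univ]

/-- The zero class. -/
instance CechH.instZero (n : ℕ) : Zero (CechH Y R n) :=
  ⟨Quot.mk _ ⟨FinCover.trivial Y, 0, coboundary_zero⟩⟩

/-- The unit class in degree `0`. -/
instance CechH.instOne : One (CechH Y R 0) :=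
  ⟨Quot.mk _ ⟨FinCover.trivial Y, 1, by
    funext s
    simp [coboundary, Fin.sum_univ_succ]⟩⟩

/-- The homomorphism `f^*` induced by a continuous map. -/
def CechH.map (f : C(Z, Y)) {n : ℕ} : CechH Y R n → CechH Z R n :=
  Quot.map
    (fun x => ⟨x.cover.preimage f, pull f id (fun _ _ hz => hz) x.cochain, 
      coboundary_pull_eq_zero _ _ _ x.closed⟩)
    (by
      rintro x y ⟨π, h, hc⟩
      exact ⟨π, fun j _ hz => h j hz, hc.pull f id (fun _ _ hz => hz)⟩)

/-- The cup product of two cocycles: pull both back to the common refinement and multiply. -/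
abbrev CechCocycle.cup {p q : ℕ} (x : CechCocycle Y R p) (y : CechCocycle Y R q) :
    CechCocycle Y R (p + q) where
  cover := x.cover.join y.cover
  cochain := cochainCup (pull id Prod.fst (fun _ _ hz => hz.1) x.cochain)
    (pull id Prod.snd (fun _ _ hz => hz.2) y.cochain)
  closed := coboundary_cup_eq_zero
    (coboundary_pull_eq_zero _ _ _ x.closed) (coboundary_pull_eq_zero _ _ _ y.closed)

/-- The cup product in Čech cohomology. -/
def CechH.cup {p q : ℕ} : CechH Y R p → CechH Y R q → CechH Y R (p + q) :=
  Quot.map₂ CechCocycle.cup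
    (by
      rintro x y y' ⟨π, h, hc⟩
      refine ⟨Prod.map id π, fun j z hz => ⟨hz.1, h _ hz.2⟩, ?_⟩
      have key := IsCoboundary.cup_left
        (a := pull (V := (x.cover.join y'.cover).U) id Prod.fst (fun _ _ hz => hz.1) x.cochain)
        (coboundary_pull_eq_zero _ _ _ x.closed)
        (hc.pull (V := (x.cover.join y'.cover).U) id Prod.snd (fun _ _ hz => hz.2))
      refine (congrArg IsCoboundary ?_).mpr key
      funext s
      exact (mul_sub _ _ _).symm)
    (by
      rintro x x' y ⟨π, h, hc⟩
      refine ⟨Prod.map π id, fun j z hz => ⟨h _ hz.1, hz.2⟩, ?_⟩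
      have key := IsCoboundary.cup_right
        (b := pull (V := (x'.cover.join y.cover).U) id Prod.snd (fun _ _ hz => hz.2) y.cochain)
        (hc.pull (V := (x'.cover.join y.cover).U) id Prod.fst (fun _ _ hz => hz.1))
        (coboundary_pull_eq_zero _ _ _ y.closed)
      refine (congrArg IsCoboundary ?_).mpr key
      funext s
      exact (sub_mul _ _ _).symm)

/-- The cup product of a list of classes of degree `k`; the empty product is `1`. -/
def CechH.cupList {k : ℕ} : (l : List (CechH Y R k)) → CechH Y R (k * l.length)
  | [] => (1 : CechH Y R 0)
  | η :: l => CechH.cup (CechH.cupList l) η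

end CechOps

/-! ### Covers of closed subsets -/

section Covers

variable {X : Type u} [TopologicalSpace X]

/-- `𝒰` is a finite open cover of `Y` in `X`: finitely many nonempty open subsets of `X` whose
union contains `Y`. -/
structure IsFinOpenCover (Y : Set X) (𝒰 : Set (Set X)) : Prop where
  finite : 𝒰.Finite
  isOpen : ∀ U ∈ 𝒰, IsOpen U
  nonempty : ∀ U ∈ 𝒰, U.Nonempty
  covers : Y ⊆ ⋃₀ 𝒰

/-- The order of a finite collection of sets: the maximal number of members with a common point,
minus one (so `-1` for the empty collection). -/
def ord (𝒰 : Set (Set X)) : ℤ :=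
  ((⨆ x : X, {U ∈ 𝒰 | x ∈ U}.ncard : ℕ) : ℤ) - 1

/-- `𝒱` refines `𝒰`. -/
def Refines (𝒱 𝒰 : Set (Set X)) : Prop :=
  ∀ V ∈ 𝒱, ∃ U ∈ 𝒰, V ⊆ U

/-- `𝒟_Y(𝒰)`: the least order of a refinement of `𝒰` among finite open covers of `Y` in `X`. -/
def coverDim (Y : Set X) (𝒰 : Set (Set X)) : ℤ :=
  sInf {n | ∃ 𝒱, IsFinOpenCover Y 𝒱 ∧ Refines 𝒱 𝒰 ∧ ord 𝒱 = n}

/-- `𝒰 ∩ Y`: the nonempty sets `U ∩ Y`, `U ∈ 𝒰`, as subsets of the space `Y`. -/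
def restrictCover (Y : Set X) (𝒰 : Set (Set X)) : Set (Set Y) :=
  {V | V.Nonempty ∧ ∃ U ∈ 𝒰, V = Subtype.val ⁻¹' U}

/-- `𝒰 ∩ Y` as a cover of the space `Y`, indexed by its own members. -/
abbrev IsFinOpenCover.restrict {Y : Set X} {𝒰 : Set (Set X)} (h : IsFinOpenCover Y 𝒰) :
    FinCover Y where
  ι := restrictCover Y 𝒰
  finite := by
    refine Set.Finite.to_subtype ((h.finite.image fun U => (Subtype.val ⁻¹' U : Set Y)).subset ?_)
    rintro V ⟨-, U, hU, rfl⟩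
    exact ⟨U, hU, rfl⟩
  U := fun V => V.1
  isOpen := by
    rintro ⟨V, -, U, hU, rfl⟩
    exact (h.isOpen U hU).preimage continuous_subtype_val
  covers := by
    refine Set.eq_univ_of_forall fun y => ?_
    obtain ⟨U, hU, hy⟩ := h.covers y.2
    exact Set.mem_iUnion.2 ⟨⟨Subtype.val ⁻¹' U, ⟨y, hy⟩, U, hU, rfl⟩, hy⟩

/-- `Ȟᵏ(Y; 𝒰; R)`: the classes in `Ȟᵏ(Y; R)` represented by cocycles on the nerve of `𝒰 ∩ Y`. -/
def cechFrom {Y : Set X} {𝒰 : Set (Set X)} (h : IsFinOpenCover Y 𝒰) (R : Type v) [CommRing R]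
    (k : ℕ) : Set (CechH Y R k) :=
  {η | ∃ (c : Cochain h.restrict.U R k) (hc : coboundary c = 0),
    η = Quot.mk _ ⟨h.restrict, c, hc⟩}

end Covers

/-! ### Amenable groups, mean dimension -/

/-- A nonempty finite set `F ⊆ G` with `|gF ∩ F| > (1 - δ)|F|` for all `g ∈ G₀`. -/
def IsInvariant {G : Type*} [Group G] (G₀ : Finset G) (δ : ℝ) (F : Finset G) : Prop :=
  F.Nonempty ∧
    ∀ g ∈ G₀, (1 - δ) * (F.card : ℝ) < (((g * ·) '' (F : Set G) ∩ F).ncard : ℝ)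

/-- Amenability of a discrete group (Følner's condition). -/
def IsAmenable (G : Type*) [Group G] : Prop :=
  ∀ (G₀ : Finset G) (δ : ℝ), 0 < δ → ∃ F : Finset G, IsInvariant G₀ δ F

section Dynamics

variable (G : Type*) [Group G] (X : Type u) [TopologicalSpace X] [MulAction G X]

/-- The join of the covers `T_g⁻¹(𝒰)`, `g ∈ F`: all nonempty sets `⋂_{g ∈ F} T_g⁻¹(U_g)` with
`U_g ∈ 𝒰`. -/
def dynJoin {G : Type*} [Group G] {X : Type u} [MulAction G X] (F : Finset G)
    (𝒰 : Set (Set X)) : Set (Set X) :=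
  {W | W.Nonempty ∧ ∃ V : G → Set X, (∀ g ∈ F, V g ∈ 𝒰) ∧ W = ⋂ g ∈ F, {x | g • x ∈ V g}}

/-- Mean dimension: the supremum over finite open covers `𝒰` of `X` of the limit of
`𝒟(⋁_{g ∈ F} T_g⁻¹ 𝒰) / |F|` as `F` becomes more and more invariant. The limit exists for
amenable groups (Ornstein and Weiss), so it is written as an upper limit. -/
def mdim : ℝ≥0∞ :=
  ⨆ (𝒰 : Set (Set X)) (_ : IsFinOpenCover Set.univ 𝒰),
    ⨅ (G₀ : Finset G) (δ : ℝ) (_ : 0 < δ),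
      ⨆ (F : Finset G) (_ : IsInvariant G₀ δ F),
        ENNReal.ofReal ((coverDim Set.univ (dynJoin F 𝒰) : ℝ) / F.card)

variable {G X}

/-- `⋂_{h ∈ F₀} T_h⁻¹(Y)`. -/
def interPreimage (F₀ : Finset G) (Y : Set X) : Set X :=
  {x | ∀ h ∈ F₀, h • x ∈ Y}

/-- For `g ∈ F₀`, the map `⋂_{h ∈ F₀} T_h⁻¹(Y) → Y`, `x ↦ T_g x`. Pulling back along it is
applying `T_g^*` and restricting to the intersection. -/
def translate [ContinuousConstSMul G X] (F₀ : Finset G) (Y : Set X) (g : F₀) :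
    C(interPreimage F₀ Y, Y) where
  toFun x := ⟨g.1 • x.1, x.2 g.1 g.2⟩
  continuous_toFun := (continuous_subtype_val.const_smul g.1).subtype_mk _

/-- The cup product of the classes `T_g^*(η)`, in the order given by the list `l`. -/
def orbitCup [ContinuousConstSMul G X] {R : Type v} [CommRing R] {k : ℕ} (F₀ : Finset G)
    (Y : Set X) (η : CechH Y R k) (l : List F₀) :
    CechH (interPreimage F₀ Y) R (k * (l.map fun g => CechH.map (translate F₀ Y g) η).length) :=
  CechH.cupList (l.map fun g => CechH.map (translate F₀ Y g) η)

variable (G X)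

/-- The condition on `d` in the definition of `mcid_k(T; R)`. The cup product over `F₀` is taken
along an enumeration of `F₀`; for even `k` classes of degree `k` commute, so that the
enumeration is irrelevant. -/
def McidCondition [ContinuousConstSMul G X] (R : Type v) [CommRing R] (k : ℕ) (d : ℝ) : Prop :=
  ∀ ε : ℝ, 0 < ε →
    ∃ (Y : Set X) (_ : IsClosed Y) (𝒰 : Set (Set X)) (h𝒰 : IsFinOpenCover Y 𝒰)
      (_ : coverDim Y 𝒰 = k ∨ coverDim Y 𝒰 = k + 1) (η : CechH Y R k) (_ : η ∈ cechFrom h𝒰 R k),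
      ∀ (G₀ : Finset G) (δ : ℝ), 0 < δ →
        ∃ (F : Finset G) (_ : IsInvariant G₀ δ F) (F₀ : Finset G) (_ : F₀ ⊆ F),
          (∃ l : List F₀, l.Nodup ∧ (∀ g, g ∈ l) ∧ orbitCup F₀ Y η l ≠ 0) ∧
          d - ε < (k : ℝ) * F₀.card / F.card

/-- The mean `k`-th cohomological independence dimension with coefficients in `R`: the largest
`d ∈ [0, ∞)` with the above condition. The set of such `d` is empty or of the form `[0, r]` with
`r ≤ k`; the value is `0` if it is empty. -/
def mcid [ContinuousConstSMul G X] (R : Type v) [CommRing R] (k : ℕ) : ℝ≥0∞ :=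
  ⨆ (d : ℝ≥0) (_ : McidCondition G X R k d), (d : ℝ≥0∞)

end Dynamics

end MeanCoh

end

noncomputable section

namespace MeanCoh

universe u v

/-! ### The augmented complex of ordered chains, with tuples of vertices written as lists -/

section OrderedChains

variable {ι : Type*} {R : Type*} [CommRing R]

/-! Suppose that $\eta$ comes from a cover $\mathcal U$ of $Y$ and that the product of the
$T_g^*\eta$, $g\in F_0\subseteq F$, is nonzero on $Z=\bigcap_{h\in F_0}T_h^{-1}Y$. Add $Y^c$ to
$\mathcal U$ to obtain a cover of $X$, and let $\mathcal V$ be an optimal refinement of its join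
over $F$. A member of $\mathcal V$ that meets $Z$ lies, for each $g\in F_0$, in some $T_g^{-1}U$
with $U\in\mathcal U$, because $Y^c$ cannot occur there. Hence every $T_g^*\eta$, and so their
product, is represented on the nerve of $\mathcal V$ over $Z$. Cohomology vanishes above the
dimension of that nerve, so $k|F_0|\le\mathrm{ord}(\mathcal V)$ when the degree is positive
(`degree_le_coverDim`). Dividing by $|F|$ gives the theorem.

Cochains here live on all ordered tuples, including those with repeated vertices, so vanishing above
the dimension is not immediate. It follows from a chain homotopy, supported on the vertices of each
simplex, between the identity and the map that sorts vertices and kills repetitions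
(`bd_sortHtpyList`, `isCoboundary_of_not_injective`). -/

theorem linearCombination_mem {α M : Type*} [AddCommGroup M] [Module R M] (f : α → M)
    {A : Set α} {N : Submodule R M} (h : ∀ a ∈ A, f a ∈ N) {x : α →₀ R}
    (hx : x ∈ Finsupp.supported R R A) : Finsupp.linearCombination R f x ∈ N := by
  rw [Finsupp.linearCombination_apply]
  exact N.sum_mem fun a ha => N.smul_mem _ (h a (hx ha))

/-- Some identities below hold only on increasing simplices; this carries them over to chains of
such simplices. -/
theorem eq_on_supported {α M : Type*} [AddCommGroup M] [Module R M] {f g : (α →₀ R) →ₗ[R] M}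
    {A : Set α} (h : ∀ a ∈ A, f (Finsupp.single a 1) = g (Finsupp.single a 1)) {x : α →₀ R}
    (hx : x ∈ Finsupp.supported R R A) : f x = g x := by
  rw [Finsupp.supported_eq_span_single] at hx
  refine LinearMap.eqOn_span' (f := f) (g := g) ?_ hx
  rintro _ ⟨a, ha, rfl⟩
  exact h a ha

/-- Prepending a vertex to every simplex of a chain. -/
def cone (R : Type*) [CommRing R] (v : ι) : (List ι →₀ R) →ₗ[R] (List ι →₀ R) :=
  Finsupp.lmapDomain R R (List.cons v)

@[simp] theorem cone_single (v : ι) (l : List ι) (r : R) :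
    cone R v (Finsupp.single l r) = Finsupp.single (v :: l) r := by
  simp [cone]

/-- The boundary of an ordered simplex. -/
def bdList (R : Type*) [CommRing R] : List ι → (List ι →₀ R)
  | [] => 0
  | v :: l => Finsupp.single l 1 - cone R v (bdList R l)

/-- The boundary of an ordered chain. -/
def bd (R : Type*) [CommRing R] : (List ι →₀ R) →ₗ[R] (List ι →₀ R) :=
  Finsupp.linearCombination R (bdList R)

@[simp] theorem bd_nil : bd R (Finsupp.single ([] : List ι) (1 : R)) = 0 := by
  simp [bd, bdList]

/-- Coning contracts the augmented complex. Every nonempty simplex is a cone over its tail, so the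
later boundary computations reduce to this identity. -/
theorem bd_cone (v : ι) (x : List ι →₀ R) : bd R (cone R v x) = x - cone R v (bd R x) := by
  suffices bd R ∘ₗ cone R v = LinearMap.id - cone R v ∘ₗ bd R from LinearMap.congr_fun this x
  ext l : 2
  simp [bd, bdList]

@[simp] theorem bd_cons (v : ι) (l : List ι) : bd R (Finsupp.single (v :: l) (1 : R)) =
    Finsupp.single l 1 - cone R v (bd R (Finsupp.single l 1)) := by
  rw [← cone_single, bd_cone]

/-- The ordered simplices with `n` vertices, all in `T`. -/
def ordered (T : Set ι) (n : ℕ) : Set (List ι) :=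
  {l | l.length = n ∧ ∀ x ∈ l, x ∈ T}

theorem cons_mem_ordered {T : Set ι} {n : ℕ} {v : ι} (hv : v ∈ T) {l : List ι}
    (hl : l ∈ ordered T n) : v :: l ∈ ordered T (n + 1) :=
  ⟨by simp [hl.1], by simpa [hv] using hl.2⟩

theorem cone_mem {A B : Set (List ι)} {v : ι} (h : ∀ l ∈ A, v :: l ∈ B) {x : List ι →₀ R}
    (hx : x ∈ Finsupp.supported R R A) : cone R v x ∈ Finsupp.supported R R B := by
  have := linearCombination_mem (fun l => Finsupp.single (v :: l) (1 : R))
    (fun l hl => Finsupp.single_mem_supported R 1 (h l hl)) hx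
  refine (congrArg (· ∈ Finsupp.supported R R B) ?_).mpr this
  refine LinearMap.congr_fun (?_ : cone R v = Finsupp.linearCombination R _) x
  ext l : 2
  simp

/-! ### Signed insertion of a vertex, and sorting up to homotopy. -/

variable [LinearOrder ι]

/-- Signed insertion of a vertex into an increasing simplex. -/
def insList (R : Type*) [CommRing R] (v : ι) : List ι → (List ι →₀ R)
  | [] => Finsupp.single [v] 1
  | u :: l => if v < u then Finsupp.single (v :: u :: l) 1 else if v = u then 0 else
      -cone R u (insList R v l)

/-- Signed insertion of a vertex into the simplices of a chain. -/
def ins (R : Type*) [CommRing R] (v : ι) : (List ι →₀ R) →ₗ[R] (List ι →₀ R) :=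
  Finsupp.linearCombination R (insList R v)

/-- The homotopy between `cone` and `ins` on an increasing simplex. -/
def insHtpyList (R : Type*) [CommRing R] (v : ι) : List ι → (List ι →₀ R)
  | [] => 0
  | u :: l => if v < u then 0 else if v = u then -Finsupp.single (v :: v :: v :: l) 1 else
      -(Finsupp.single (v :: u :: v :: l) 1 + Finsupp.single (v :: v :: v :: l) 1) +
        cone R u (insHtpyList R v l)

/-- The homotopy between `cone` and `ins`. -/
def insHtpy (R : Type*) [CommRing R] (v : ι) : (List ι →₀ R) →ₗ[R] (List ι →₀ R) :=
  Finsupp.linearCombination R (insHtpyList R v)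

theorem ins_cone_of_lt {v u : ι} (h : v < u) (x : List ι →₀ R) :
    ins R v (cone R u x) = cone R v (cone R u x) := by
  suffices ins R v ∘ₗ cone R u = cone R v ∘ₗ cone R u from LinearMap.congr_fun this x
  ext l : 2
  simp [ins, insList, h]

theorem ins_cone_self (v : ι) (x : List ι →₀ R) : ins R v (cone R v x) = 0 := by
  suffices ins R v ∘ₗ cone R v = 0 from LinearMap.congr_fun this x
  ext l : 2
  simp [ins, insList]

theorem ins_cone_of_gt {v u : ι} (h : u < v) (x : List ι →₀ R) :
    ins R v (cone R u x) = -cone R u (ins R v x) := by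
  suffices ins R v ∘ₗ cone R u = -(cone R u ∘ₗ ins R v) from LinearMap.congr_fun this x
  ext l : 2
  simp [ins, insList, h.not_gt, h.ne']

theorem insHtpy_cone_of_lt {v u : ι} (h : v < u) (x : List ι →₀ R) :
    insHtpy R v (cone R u x) = 0 := by
  suffices insHtpy R v ∘ₗ cone R u = 0 from LinearMap.congr_fun this x
  ext l : 2
  simp [insHtpy, insHtpyList, h]

theorem insHtpy_cone_self (v : ι) (x : List ι →₀ R) :
    insHtpy R v (cone R v x) = -cone R v (cone R v (cone R v x)) := by
  suffices insHtpy R v ∘ₗ cone R v = -(cone R v ∘ₗ cone R v ∘ₗ cone R v) from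
    LinearMap.congr_fun this x
  ext l : 2
  simp [insHtpy, insHtpyList]

theorem insHtpy_cone_of_gt {v u : ι} (h : u < v) (x : List ι →₀ R) :
    insHtpy R v (cone R u x) =
      -(cone R v (cone R u (cone R v x)) + cone R v (cone R v (cone R v x))) +
        cone R u (insHtpy R v x) := by
  suffices insHtpy R v ∘ₗ cone R u =
      -(cone R v ∘ₗ cone R u ∘ₗ cone R v + cone R v ∘ₗ cone R v ∘ₗ cone R v) +
        cone R u ∘ₗ insHtpy R v from LinearMap.congr_fun this x
  ext l : 2
  simp [insHtpy, insHtpyList, h.not_gt, h.ne']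

theorem ins_single_of_lt {v : ι} {l : List ι} (h : ∀ u ∈ l, v < u) :
    ins R v (Finsupp.single l 1) = Finsupp.single (v :: l) 1 := by
  cases l with
  | nil => simp [ins, insList]
  | cons u l => simp [ins, insList, h u]

theorem insHtpy_single_of_lt {v : ι} {l : List ι} (h : ∀ u ∈ l, v < u) :
    insHtpy R v (Finsupp.single l 1) = 0 := by
  cases l with
  | nil => simp [insHtpy, insHtpyList]
  | cons u l => simp [insHtpy, insHtpyList, h u]

/-- Insertion satisfies the same boundary relation as coning. Monotonicity matters when $v\le u$:
insertion into the face that omits $u$ must still put $v$ in front. -/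
theorem bd_ins_single (v : ι) {l : List ι} (hl : l.Pairwise (· < ·)) :
    bd R (ins R v (Finsupp.single l 1)) =
      Finsupp.single l 1 - ins R v (bd R (Finsupp.single l 1)) := by
  induction l with
  | nil => simp [ins, insList]
  | cons u l ih =>
    obtain ⟨hu, hl⟩ := List.pairwise_cons.1 hl
    rw [← cone_single, bd_cone, map_sub]
    rcases lt_trichotomy v u with h | rfl | h
    · rw [ins_cone_of_lt h, ins_cone_of_lt h, ins_single_of_lt fun x hx => h.trans (hu x hx),
        bd_cone, bd_cone, map_sub, cone_single v l]
    · rw [ins_cone_self, ins_cone_self, ins_single_of_lt hu, cone_single]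
      simp
    · rw [ins_cone_of_gt h, ins_cone_of_gt h, map_neg, bd_cone, ih hl, map_sub]
      abel

/-- Both `ins` and `cone` satisfy $\partial f+f\partial=1$, so their difference anticommutes with
$\partial$; this explains the minus sign on the left. For $u<v$ the faces of $vuvx$ contribute
$uvx-vvx+vux$, and the extra simplex $vvvx$ cancels the degenerate term $vvx$. -/
theorem bd_insHtpy_single (v : ι) {l : List ι} (hl : l.Pairwise (· < ·)) :
    bd R (insHtpy R v (Finsupp.single l 1)) - insHtpy R v (bd R (Finsupp.single l 1)) =
      ins R v (Finsupp.single l 1) - cone R v (Finsupp.single l 1) := by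
  induction l with
  | nil => simp [ins, insList, insHtpy, insHtpyList]
  | cons u l ih =>
    obtain ⟨hu, hl⟩ := List.pairwise_cons.1 hl
    rw [← cone_single, bd_cone, map_sub]
    rcases lt_trichotomy v u with h | rfl | h
    · rw [insHtpy_cone_of_lt h, insHtpy_cone_of_lt h, ins_cone_of_lt h,
        insHtpy_single_of_lt fun x hx => h.trans (hu x hx)]
      simp
    · rw [insHtpy_cone_self, insHtpy_cone_self, ins_cone_self, insHtpy_single_of_lt hu]
      simp only [map_neg, bd_cone, map_sub]
      abel
    · have := ih hl
      rw [sub_eq_iff_eq_add] at this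
      rw [insHtpy_cone_of_gt h, insHtpy_cone_of_gt h, ins_cone_of_gt h]
      simp only [map_neg, map_add, bd_cone, map_sub, this]
      abel

/-- The increasing simplices with `n` vertices, all in `T`. -/
def increasing (T : Set ι) (n : ℕ) : Set (List ι) :=
  {l | l.Pairwise (· < ·) ∧ l.length = n ∧ ∀ x ∈ l, x ∈ T}

theorem increasing_subset_ordered (T : Set ι) (n : ℕ) : increasing T n ⊆ ordered T n :=
  fun _ h => h.2

theorem insList_mem {T : Set ι} {n : ℕ} {v : ι} (hv : v ∈ T) {l : List ι}
    (hl : l ∈ increasing T n) : insList R v l ∈ Finsupp.supported R R (increasing T (n + 1)) := by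
  induction l generalizing T n with
  | nil =>
    obtain rfl : n = 0 := by simpa using hl.2.1.symm
    exact Finsupp.single_mem_supported R 1 ⟨by simp, by simp, by simpa⟩
  | cons u l ih =>
    obtain ⟨h1, h2, h3⟩ := hl
    obtain ⟨hu, hl⟩ := List.pairwise_cons.1 h1
    obtain ⟨n, rfl⟩ : ∃ m, n = m + 1 := ⟨l.length, by simpa using h2.symm⟩
    have hT := List.forall_mem_cons.1 h3
    rw [insList]
    split_ifs with h h'
    · refine Finsupp.single_mem_supported R 1 ⟨List.pairwise_cons.2 ⟨fun x hx => ?_, h1⟩, ?_, ?_⟩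
      · rcases List.mem_cons.1 hx with rfl | hx
        exacts [h, h.trans (hu x hx)]
      · simpa using h2
      · exact List.forall_mem_cons.2 ⟨hv, h3⟩
    · exact Submodule.zero_mem _
    · have hlt : u < v := lt_of_le_of_ne (not_lt.1 h) (Ne.symm h')
      -- Shrinking $T$ to its elements above $u$ ensures that prepending $u$ keeps the simplices
      -- increasing.
      refine Submodule.neg_mem _ (cone_mem (A := increasing {x ∈ T | u < x} (n + 1)) ?_
        (ih ⟨hv, hlt⟩ ⟨hl, by simpa using h2, fun x hx => ⟨hT.2 x hx, hu x hx⟩⟩))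
      rintro w ⟨w1, w2, w3⟩
      exact ⟨List.pairwise_cons.2 ⟨fun x hx => (w3 x hx).2, w1⟩, by simp [w2],
        List.forall_mem_cons.2 ⟨hT.1, fun x hx => (w3 x hx).1⟩⟩

/-- No vertex outside $T$ is introduced. Hence the homotopy of a simplex of the nerve stays in the
nerve, where cochains can be evaluated. -/
theorem insHtpyList_mem {T : Set ι} {n : ℕ} {v : ι} (hv : v ∈ T) {l : List ι}
    (hl : l ∈ ordered T n) : insHtpyList R v l ∈ Finsupp.supported R R (ordered T (n + 2)) := by
  induction l generalizing n with
  | nil => exact Submodule.zero_mem _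
  | cons u l ih =>
    obtain ⟨n, rfl⟩ : ∃ m, n = m + 1 := ⟨l.length, by simpa using hl.1.symm⟩
    have hT := List.forall_mem_cons.1 hl.2
    have hl' : l ∈ ordered T n := ⟨by simpa using hl.1, hT.2⟩
    have hvvv := Finsupp.single_mem_supported R (1 : R)
      (cons_mem_ordered hv (cons_mem_ordered hv (cons_mem_ordered hv hl')))
    rw [insHtpyList]
    split_ifs
    · exact Submodule.zero_mem _
    · exact Submodule.neg_mem _ hvvv
    · refine Submodule.add_mem _ (Submodule.neg_mem _ (Submodule.add_mem _ ?_ hvvv))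
        (cone_mem (fun _ => cons_mem_ordered hT.1) (ih hl'))
      exact Finsupp.single_mem_supported R (1 : R)
        (cons_mem_ordered hv (cons_mem_ordered hT.1 (cons_mem_ordered hv hl')))

/-- The increasing simplex, with sign, on the vertices of an ordered simplex; zero if there are
repeated vertices. -/
def sortList (R : Type*) [CommRing R] : List ι → (List ι →₀ R)
  | [] => Finsupp.single [] 1
  | v :: l => ins R v (sortList R l)

/-- The homotopy between the identity and sorting. -/
def sortHtpyList (R : Type*) [CommRing R] : List ι → (List ι →₀ R)
  | [] => 0
  | v :: l => -cone R v (sortHtpyList R l) + insHtpy R v (sortList R l)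

theorem sortList_mem {T : Set ι} {n : ℕ} {l : List ι} (hl : l ∈ ordered T n) :
    sortList R l ∈ Finsupp.supported R R (increasing T n) := by
  induction l generalizing n with
  | nil => exact Finsupp.single_mem_supported R 1 ⟨by simp, hl⟩
  | cons v l ih =>
    obtain ⟨n, rfl⟩ : ∃ m, n = m + 1 := ⟨l.length, by simpa using hl.1.symm⟩
    have hT := List.forall_mem_cons.1 hl.2
    exact linearCombination_mem _ (fun _ => insList_mem hT.1) (ih ⟨by simpa using hl.1, hT.2⟩)

theorem sortHtpyList_mem {T : Set ι} {n : ℕ} {l : List ι} (hl : l ∈ ordered T n) :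
    sortHtpyList R l ∈ Finsupp.supported R R (ordered T (n + 1)) := by
  induction l generalizing n with
  | nil => exact Submodule.zero_mem _
  | cons v l ih =>
    obtain ⟨n, rfl⟩ : ∃ m, n = m + 1 := ⟨l.length, by simpa using hl.1.symm⟩
    have hT := List.forall_mem_cons.1 hl.2
    have hl' : l ∈ ordered T n := ⟨by simpa using hl.1, hT.2⟩
    refine Submodule.add_mem _
      (Submodule.neg_mem _ (cone_mem (fun _ => cons_mem_ordered hT.1) (ih hl'))) ?_
    exact linearCombination_mem _
      (fun _ h => insHtpyList_mem hT.1 (increasing_subset_ordered T n h)) (sortList_mem hl')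

theorem sortList_mem_pairwise (l : List ι) :
    sortList R l ∈ Finsupp.supported R R {l : List ι | l.Pairwise (· < ·)} :=
  Finsupp.supported_mono (fun _ h => h.1)
    (sortList_mem (T := Set.univ) (n := l.length) ⟨rfl, fun _ _ => trivial⟩)

/-- Sorting is a chain map: it turns `cone` into `ins`, and the two obey the same boundary relation,
the latter on increasing chains, which the values of `sortList` are. -/
theorem bd_sortList (l : List ι) :
    bd R (sortList R l) = Finsupp.linearCombination R (sortList R) (bdList R l) := by
  induction l with
  | nil => simp [sortList, bdList]
  | cons v l ih =>
    have h1 : bd R (ins R v (sortList R l)) = sortList R l - ins R v (bd R (sortList R l)) :=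
      eq_on_supported (f := bd R ∘ₗ ins R v) (g := LinearMap.id - ins R v ∘ₗ bd R)
        (fun _ h => bd_ins_single v h) (sortList_mem_pairwise l)
    have h2 : Finsupp.linearCombination R (sortList R) ∘ₗ cone R v =
        ins R v ∘ₗ Finsupp.linearCombination R (sortList R) := by
      ext w : 2
      simp [sortList]
    rw [sortList, h1, ih, bdList, map_sub]
    have h3 := LinearMap.congr_fun h2 (bdList R l)
    simp only [LinearMap.comp_apply] at h3
    rw [h3]
    simp

/-- Sorting is chain homotopic to the identity. -/
theorem bd_sortHtpyList (l : List ι) :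
    bd R (sortHtpyList R l) + Finsupp.linearCombination R (sortHtpyList R) (bdList R l) =
      sortList R l - Finsupp.single l 1 := by
  induction l with
  | nil => simp [sortHtpyList, sortList, bdList]
  | cons v l ih =>
    have h1 : bd R (insHtpy R v (sortList R l)) - insHtpy R v (bd R (sortList R l)) =
        ins R v (sortList R l) - cone R v (sortList R l) :=
      eq_on_supported (f := bd R ∘ₗ insHtpy R v - insHtpy R v ∘ₗ bd R)
        (g := ins R v - cone R v) (fun _ h => bd_insHtpy_single v h) (sortList_mem_pairwise l)
    have h2 : Finsupp.linearCombination R (sortHtpyList R) ∘ₗ cone R v =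
        -(cone R v ∘ₗ Finsupp.linearCombination R (sortHtpyList R)) +
          insHtpy R v ∘ₗ Finsupp.linearCombination R (sortList R) := by
      ext w : 2
      simp [sortHtpyList]
    have h3 := LinearMap.congr_fun h2 (bdList R l)
    simp only [LinearMap.comp_apply, LinearMap.add_apply, LinearMap.neg_apply,
      ← bd_sortList] at h3
    have h4 : Finsupp.linearCombination R (sortHtpyList R) (Finsupp.single l (1 : R)) =
      sortHtpyList R l := by simp
    rw [sub_eq_iff_eq_add] at h1
    rw [← eq_sub_iff_add_eq] at ih
    rw [sortHtpyList, sortList, bdList, map_sub, h3, h4, map_add, map_neg, bd_cone, ih, h1,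
      ← cone_single]
    simp only [map_sub]
    abel

end OrderedChains

/-! ### Vanishing of the cohomology of a nerve above its dimension -/

section Vanishing

variable {Y : Type u} {ι : Type u} {U : ι → Set Y} {R : Type v} [CommRing R]

/-- This links the recursive boundary with the alternating sum over faces in `coboundary`. -/
theorem bdList_ofFn {ι : Type*} {n : ℕ} (s : Fin (n + 1) → ι) :
    bdList R (List.ofFn s) =
      ∑ i : Fin (n + 1), Finsupp.single (List.ofFn (s ∘ i.succAbove)) ((-1 : R) ^ (i : ℕ)) := by
  induction n with
  | zero => simp [bdList]
  | succ n ih =>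
    rw [List.ofFn_succ, bdList, ih, map_sum, Fin.sum_univ_succ (n := n + 1), sub_eq_add_neg,
      ← Finset.sum_neg_distrib]
    congr 1
    · simp [Function.comp_def]
    · refine Finset.sum_congr rfl fun i _ => ?_
      rw [cone_single, ← Finsupp.single_neg, List.ofFn_succ]
      simp [Function.comp_def, pow_succ]

open Classical in
/-- A cochain as a function on all lists of vertices. -/
def Cochain.onList {m : ℕ} (c : Cochain U R m) (l : List ι) : R :=
  if h : ∃ s : Simplex U m, List.ofFn s.1 = l then c h.choose else 0

theorem Cochain.onList_ofFn {m : ℕ} (c : Cochain U R m) (s : Simplex U m) :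
    c.onList (List.ofFn s.1) = c s := by
  have h : ∃ t : Simplex U m, List.ofFn t.1 = List.ofFn s.1 := ⟨s, rfl⟩
  rw [Cochain.onList, dif_pos h]
  exact congrArg c (Subtype.ext (List.ofFn_injective h.choose_spec))

theorem linearCombination_onList_bdList {m : ℕ} (c : Cochain U R m) (s : Simplex U (m + 1)) :
    Finsupp.linearCombination R c.onList (bdList R (List.ofFn s.1)) = coboundary c s := by
  rw [bdList_ofFn, map_sum]
  refine Finset.sum_congr rfl fun i _ => ?_
  rw [Finsupp.linearCombination_single, smul_eq_mul]
  exact congrArg _ (c.onList_ofFn (s.comp i.succAbove))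

/-- The tuples with entries in the vertex set of a simplex are simplices. -/
theorem exists_simplex_of_mem_ordered {m n : ℕ} (s : Simplex U m) {l : List ι}
    (hl : l ∈ ordered (Set.range s.1) (n + 1)) : ∃ t : Simplex U n, List.ofFn t.1 = l := by
  obtain ⟨h1, h2⟩ := hl
  obtain ⟨t, rfl⟩ : ∃ t : Fin (n + 1) → ι, List.ofFn t = l := by
    rw [← h1]
    exact ⟨l.get, List.ofFn_get l⟩
  refine ⟨⟨t, s.2.mono fun x hx => Set.mem_iInter.2 fun i => ?_⟩, rfl⟩
  obtain ⟨j, hj⟩ := h2 (t i) (List.mem_ofFn.2 ⟨i, rfl⟩)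
  rw [← hj]
  exact Set.mem_iInter.1 hx j

/-- In positive degrees where every simplex has a repeated vertex, cocycles are coboundaries. -/
theorem isCoboundary_of_not_injective {m : ℕ} (hm : 0 < m)
    (hU : ∀ s : Simplex U m, ¬ Function.Injective s.1) {c : Cochain U R m}
    (hc : coboundary c = 0) : IsCoboundary c := by
  obtain ⟨m, rfl⟩ : ∃ p, m = p + 1 := ⟨m - 1, by omega⟩
  -- Any total order on the indices will do; it serves only to sort.
  let _ : LinearOrder ι := IsWellOrder.linearOrder WellOrderingRel
  let ev := Finsupp.linearCombination R c.onList
  -- Apply $c$ to $\partial H+H\partial=\mathrm{sort}-1$. Both $c\circ\mathrm{sort}$ and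
  -- $c\circ\partial$ vanish, so $c=-c\circ H\circ\partial$ is the coboundary of $-c\circ H$.
  refine Or.inr ⟨m, rfl, fun t => -ev (sortHtpyList R (List.ofFn t.1)), fun s => ?_⟩
  have hmem : List.ofFn s.1 ∈ ordered (Set.range s.1) (m + 2) :=
    ⟨by simp, fun x hx => List.mem_ofFn.1 hx⟩
  have h1 : ev (sortList R (List.ofFn s.1)) = 0 := by
    -- A strictly increasing tuple of vertices of $s$ would be an injective simplex.
    have : increasing (Set.range s.1) (m + 2) = ∅ := by
      refine Set.eq_empty_of_forall_notMem fun l hl => ?_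
      obtain ⟨t, rfl⟩ := exists_simplex_of_mem_ordered s hl.2
      exact hU t (List.nodup_ofFn.1 (hl.1.imp fun h => h.ne))
    have h := sortList_mem (R := R) hmem
    rw [this, Finsupp.supported_empty, Submodule.mem_bot] at h
    rw [h, map_zero]
  have h2 : ev (bd R (sortHtpyList R (List.ofFn s.1))) = 0 := by
    refine eq_on_supported (f := ev ∘ₗ bd R) (g := 0) (fun l hl => ?_) (sortHtpyList_mem hmem)
    obtain ⟨t, rfl⟩ := exists_simplex_of_mem_ordered s hl
    have := linearCombination_onList_bdList c t
    rw [hc] at this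
    simpa [ev, bd] using this
  have h3 : ev (Finsupp.linearCombination R (sortHtpyList R) (bdList R (List.ofFn s.1))) =
      -coboundary (fun t : Simplex U m => -ev (sortHtpyList R (List.ofFn t.1))) s := by
    rw [bdList_ofFn, map_sum, map_sum, coboundary, ← Finset.sum_neg_distrib]
    refine Finset.sum_congr rfl fun i _ => ?_
    rw [Finsupp.linearCombination_single, map_smul, smul_eq_mul, mul_neg, neg_neg]
    rfl
  have h4 := congrArg ev (bd_sortHtpyList (R := R) (List.ofFn s.1))
  rw [map_add, map_sub, h1, h2, h3, Finsupp.linearCombination_single, one_smul,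
    c.onList_ofFn, zero_add, zero_sub, neg_inj] at h4
  exact h4.symm

end Vanishing

/-! ### Classes represented on the nerve of a given cover -/

section Represented

variable {Y : Type u} [TopologicalSpace Y] {R : Type v} [CommRing R]

/-- The class is represented by a cocycle on the nerve of `𝒱`. -/
def RepresentedOn (𝒱 : FinCover Y) {n : ℕ} (ξ : CechH Y R n) : Prop :=
  ∃ (c : Cochain 𝒱.U R n) (hc : coboundary c = 0), ξ = Quot.mk _ ⟨𝒱, c, hc⟩

theorem RepresentedOn.of_refines {𝒱 : FinCover Y} {n : ℕ} (x : CechCocycle Y R n)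
    (π : 𝒱.ι → x.cover.ι) (h : ∀ j, 𝒱.U j ⊆ x.cover.U (π j)) :
    RepresentedOn 𝒱 (Quot.mk _ x : CechH Y R n) :=
  ⟨pull id π h x.cochain, coboundary_pull_eq_zero _ _ _ x.closed,
    Quot.sound ⟨π, h, Or.inl (sub_self _)⟩⟩

theorem RepresentedOn.cup {𝒱 : FinCover Y} {p q : ℕ} {ξ : CechH Y R p} {ζ : CechH Y R q}
    (hξ : RepresentedOn 𝒱 ξ) (hζ : RepresentedOn 𝒱 ζ) : RepresentedOn 𝒱 (CechH.cup ξ ζ) := by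
  obtain ⟨c, hc, rfl⟩ := hξ
  obtain ⟨e, he, rfl⟩ := hζ
  -- The product lives on the join of $\mathcal V$ with itself, which $\mathcal V$ refines along the
  -- diagonal.
  exact .of_refines (CechCocycle.cup ⟨𝒱, c, hc⟩ ⟨𝒱, e, he⟩) (fun j => (j, j)) fun _ _ hx => ⟨hx, hx⟩

theorem RepresentedOn.cupList {𝒱 : FinCover Y} {k : ℕ} {l : List (CechH Y R k)}
    (hl : ∀ ξ ∈ l, RepresentedOn 𝒱 ξ) : RepresentedOn 𝒱 (CechH.cupList l) := by
  induction l with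
  | nil => exact .of_refines _ (fun _ => PUnit.unit) fun _ _ _ => trivial
  | cons ξ l ih =>
    exact (ih fun ζ hζ => hl ζ (List.mem_cons_of_mem _ hζ)).cup (hl ξ List.mem_cons_self)

theorem RepresentedOn.eq_zero {𝒱 : FinCover Y} {n : ℕ} (hn : 0 < n)
    (h𝒱 : ∀ s : Simplex 𝒱.U n, ¬ Function.Injective s.1) {ξ : CechH Y R n}
    (hξ : RepresentedOn 𝒱 ξ) : ξ = 0 := by
  obtain ⟨c, hc, rfl⟩ := hξ
  -- The zero class is given on the one-element cover, which $\mathcal V$ refines; what remains is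
  -- that $c-0$ is a coboundary.
  refine (Quot.sound ⟨fun _ => PUnit.unit, fun _ _ _ => trivial, ?_⟩).symm
  exact isCoboundary_of_not_injective hn h𝒱 ((congrArg coboundary (sub_zero c)).trans hc)

end Represented

/-! ### Covers of the space and of its subsets -/

section CoverLemmas

variable {X : Type u}

/-- Boundedness makes the supremum in `ord` genuine; an unbounded supremum in `ℕ` takes the default
value $0$. -/
theorem bddAbove_ncard {𝒱 : Set (Set X)} (h : 𝒱.Finite) :
    BddAbove (Set.range fun x : X => {V ∈ 𝒱 | x ∈ V}.ncard) := by
  refine ⟨𝒱.ncard, ?_⟩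
  rintro _ ⟨x, rfl⟩
  exact Set.ncard_le_ncard (Set.sep_subset _ _) h

theorem ncard_le_ord {𝒱 : Set (Set X)} (h : 𝒱.Finite) (x : X) :
    ({V ∈ 𝒱 | x ∈ V}.ncard : ℤ) ≤ ord 𝒱 + 1 := by
  have := le_ciSup (bddAbove_ncard h) x
  rw [ord, sub_add_cancel]
  exact_mod_cast this

variable [TopologicalSpace X]

theorem exists_ord_eq_coverDim {Y : Set X} {𝒰 : Set (Set X)} (h : IsFinOpenCover Y 𝒰) :
    ∃ 𝒱, IsFinOpenCover Y 𝒱 ∧ Refines 𝒱 𝒰 ∧ ord 𝒱 = coverDim Y 𝒰 := by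
  -- The infimum is attained since $\mathcal U$ refines itself and no order is below $-1$.
  refine Int.csInf_mem (s := {n | ∃ 𝒱, IsFinOpenCover Y 𝒱 ∧ Refines 𝒱 𝒰 ∧ ord 𝒱 = n})
    ⟨ord 𝒰, 𝒰, h, fun U hU => ⟨U, hU, subset_rfl⟩, rfl⟩ ⟨-1, ?_⟩
  rintro _ ⟨𝒱, -, -, rfl⟩
  rw [ord]
  omega

/-- The members of a finite open cover of `X` that meet `Z`, as a cover of `Z`. -/
abbrev IsFinOpenCover.meeting {𝒱 : Set (Set X)} (h : IsFinOpenCover Set.univ 𝒱) (Z : Set X) :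
    FinCover Z where
  ι := {V : Set X // V ∈ 𝒱 ∧ (V ∩ Z).Nonempty}
  finite := (h.finite.subset fun _ hV => hV.1).to_subtype
  U := fun V => Subtype.val ⁻¹' V.1
  isOpen := fun V => (h.isOpen _ V.2.1).preimage continuous_subtype_val
  covers := by
    refine Set.eq_univ_of_forall fun z => ?_
    obtain ⟨V, hV, hz⟩ := h.covers (Set.mem_univ z.1)
    exact Set.mem_iUnion.2 ⟨⟨V, hV, z.1, hz, z.2⟩, hz⟩

/-- An injective $n$-simplex gives $n+1$ distinct members of $\mathcal V$ through one point.
Indexing by sets in $X$, not by their traces on $Z$, makes this count direct. -/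
theorem IsFinOpenCover.not_injective_simplex_meeting {𝒱 : Set (Set X)}
    (h : IsFinOpenCover Set.univ 𝒱) {Z : Set X} {n : ℕ} (hn : ord 𝒱 < n)
    (s : Simplex (h.meeting Z).U n) : ¬ Function.Injective s.1 := by
  intro hs
  obtain ⟨z, hz⟩ := s.2
  have hfin : {V ∈ 𝒱 | z.1 ∈ V}.Finite := h.finite.subset (Set.sep_subset _ _)
  have h1 : Set.range (Subtype.val ∘ s.1) ⊆ {V ∈ 𝒱 | z.1 ∈ V} := by
    rintro _ ⟨i, rfl⟩
    exact ⟨(s.1 i).2.1, Set.mem_iInter.1 hz i⟩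
  have h2 := Set.ncard_le_ncard h1 hfin
  rw [Set.ncard_range_of_injective (Subtype.val_injective.comp hs), Nat.card_eq_fintype_card,
    Fintype.card_fin] at h2
  have := ncard_le_ord h.finite z.1
  omega

/-- A cover of a closed set `Y`, completed by the complement of `Y` to a cover of the space. -/
def completeCover (Y : Set X) (𝒰 : Set (Set X)) : Set (Set X) :=
  {U | U.Nonempty ∧ (U ∈ 𝒰 ∨ U = Yᶜ)}

theorem IsFinOpenCover.completeCover {Y : Set X} (hY : IsClosed Y) {𝒰 : Set (Set X)}
    (h : IsFinOpenCover Y 𝒰) : IsFinOpenCover Set.univ (completeCover Y 𝒰) where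
  finite := (h.finite.insert Yᶜ).subset fun _ hU => hU.2.symm
  isOpen := by
    rintro U ⟨-, hU | rfl⟩
    exacts [h.isOpen U hU, hY.isOpen_compl]
  nonempty := fun _ hU => hU.1
  covers := fun x _ => by
    by_cases hx : x ∈ Y
    · obtain ⟨U, hU, hxU⟩ := h.covers hx
      exact ⟨U, ⟨⟨x, hxU⟩, Or.inl hU⟩, hxU⟩
    · exact ⟨Yᶜ, ⟨⟨x, hx⟩, Or.inr rfl⟩, hx⟩

/-! ### Joint covers and cup products along an orbit. -/

variable {G : Type*} [Group G] [MulAction G X] [ContinuousConstSMul G X]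

theorem IsFinOpenCover.dynJoin {𝒰 : Set (Set X)} (h : IsFinOpenCover Set.univ 𝒰) (F : Finset G) :
    IsFinOpenCover Set.univ (dynJoin F 𝒰) where
  finite := by
    have := h.finite.to_subtype
    -- A member of the join depends only on the values of $V$ on $F$.
    refine (Set.finite_range fun V : F → 𝒰 => ⋂ g : F, {x : X | g.1 • x ∈ (V g).1}).subset ?_
    rintro _ ⟨-, V, hV, rfl⟩
    refine ⟨fun g => ⟨V g.1, hV g.1 g.2⟩, ?_⟩
    ext x
    simp
  isOpen := by
    rintro _ ⟨-, V, hV, rfl⟩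
    exact isOpen_biInter_finset fun g hg => (h.isOpen _ (hV g hg)).preimage (continuous_const_smul g)
  nonempty := fun _ hW => hW.1
  covers := fun x _ => by
    choose V hV hx using fun g : G => h.covers (Set.mem_univ (g • x))
    have hmem : x ∈ ⋂ g ∈ F, {y : X | g • y ∈ V g} := by simpa using fun g _ => hx g
    exact ⟨_, ⟨⟨x, hmem⟩, V, fun g _ => hV g, rfl⟩, hmem⟩

/-- If the cup product over `F₀ ⊆ F` does not vanish, then its degree is at most the covering
dimension of the joint cover over `F`. -/
theorem degree_le_coverDim {R : Type v} [CommRing R] {k : ℕ} {Y : Set X} (hY : IsClosed Y)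
    {𝒰 : Set (Set X)} (h𝒰 : IsFinOpenCover Y 𝒰) {η : CechH Y R k} (hη : η ∈ cechFrom h𝒰 R k)
    {F F₀ : Finset G} (hF : F₀ ⊆ F) {l : List F₀} (hl : l.Nodup) (hl' : ∀ g, g ∈ l)
    (hne : orbitCup F₀ Y η l ≠ 0) (hpos : 0 < k * F₀.card) :
    ((k * F₀.card : ℕ) : ℤ) ≤ coverDim Set.univ (MeanCoh.dynJoin F (MeanCoh.completeCover Y 𝒰)) := by
  classical
  by_contra hlt
  rw [not_le] at hlt
  obtain ⟨𝒱, h𝒱, href, hord⟩ := exists_ord_eq_coverDim ((h𝒰.completeCover hY).dynJoin F)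
  rw [← hord] at hlt
  have hlen : k * (l.map fun g => CechH.map (translate F₀ Y g) η).length = k * F₀.card := by
    rw [List.length_map, ← List.toFinset_card_of_nodup hl,
      Finset.eq_univ_iff_forall.2 fun g => List.mem_toFinset.2 (hl' g), Finset.card_univ,
      Fintype.card_coe]
  refine hne (RepresentedOn.eq_zero (𝒱 := h𝒱.meeting _) (by omega)
    (fun s => h𝒱.not_injective_simplex_meeting (by omega) s)
    (RepresentedOn.cupList fun ξ hξ => ?_))
  obtain ⟨g, -, rfl⟩ := List.mem_map.1 hξ
  obtain ⟨c, hc, rfl⟩ := hη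
  -- A point $z\in V\cap Z$ satisfies $gz\in Y$, which excludes $Y^c$ as the set containing $gV$.
  -- This is why only members meeting $Z$ are kept.
  have key : ∀ V : (h𝒱.meeting (interPreimage F₀ Y)).ι,
      ∃ U ∈ 𝒰, (∃ y : Y, y.1 ∈ U) ∧ ∀ x ∈ V.1, g.1 • x ∈ U := by
    rintro ⟨V, hV, z, hzV, hz⟩
    obtain ⟨_, ⟨-, U, hU, rfl⟩, hVU⟩ := href V hV
    have hsub : ∀ x ∈ V, g.1 • x ∈ U g.1 := fun x hx =>
      Set.mem_iInter₂.1 (hVU hx) g.1 (hF g.2)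
    have hzY : g.1 • z ∈ Y := hz g.1 g.2
    refine ⟨U g.1, (hU g.1 (hF g.2)).2.resolve_right fun h => ?_, ⟨⟨_, hzY⟩, hsub z hzV⟩, hsub⟩
    exact (h ▸ hsub z hzV : g.1 • z ∈ Yᶜ) hzY
  choose U hU hne hsub using key
  exact .of_refines
    ⟨h𝒰.restrict.preimage (translate F₀ Y g),
      pull (translate F₀ Y g) id (fun _ _ hz => hz) c, coboundary_pull_eq_zero _ _ _ hc⟩
    (fun V => ⟨Subtype.val ⁻¹' U V, hne V, U V, hU V, rfl⟩) fun V x hx => hsub V x.1 hx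

end CoverLemmas

end MeanCoh

end

/-! ### The bound by mean dimension. -/

theorem mainTheorem6 {G : Type*} [Group G] [Countable G] (hG : MeanCoh.IsAmenable G)
    {X : Type*} [TopologicalSpace X] [CompactSpace X] [TopologicalSpace.MetrizableSpace X]
    [MulAction G X] [ContinuousConstSMul G X] (R : Type*) [CommRing R] (k : ℕ) (hk : Even k) :
    MeanCoh.mcid G X R k ≤ MeanCoh.mdim G X := by
  refine iSup₂_le fun d hd => ENNReal.le_of_forall_pos_le_add fun ε hε _ => ?_
  obtain ⟨Y, hY, 𝒰, h𝒰, -, η, hη, h⟩ := hd ε hε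
  suffices ENNReal.ofReal (d - ε) ≤ MeanCoh.mdim G X by
    rw [← tsub_le_iff_right]
    refine le_trans (le_of_eq ?_) this
    rw [ENNReal.ofReal_sub _ (NNReal.coe_nonneg ε), ENNReal.ofReal_coe_nnreal, ENNReal.ofReal_coe_nnreal]
  refine le_iSup₂_of_le (MeanCoh.completeCover Y 𝒰) (h𝒰.completeCover hY) ?_
  refine le_iInf fun G₀ => le_iInf₂ fun δ hδ => ?_
  -- Since `mdim` is written as an upper limit, one suitable $F$ for each $(G_0,\delta)$ suffices.
  obtain ⟨F, hF, F₀, hF₀, ⟨l, hl, hl', hne⟩, hlt⟩ := h G₀ δ hδ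
  refine le_iSup₂_of_le F hF ?_
  -- In total degree $0$ the vanishing argument does not apply, but then $d-\varepsilon<0$ and the
  -- bound is trivial.
  rcases Nat.eq_zero_or_pos (k * F₀.card) with h0 | hpos
  · have h0' : (k : ℝ) * F₀.card = 0 := by exact_mod_cast h0
    rw [h0', zero_div] at hlt
    rw [ENNReal.ofReal_of_nonpos hlt.le]
    exact zero_le
  · refine ENNReal.ofReal_le_ofReal (hlt.le.trans (div_le_div_of_nonneg_right ?_ F.card.cast_nonneg))
    exact_mod_cast MeanCoh.degree_le_coverDim hY h𝒰 hη hF₀ hl hl' hne hpos
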